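/- All graphs are undirected and simple. A finite connected graph $G$ is \emph{BFS-labeled} if its vertex set is $\{1,\dots,n\}$ for some $n\ge 1$ and $\operatorname{dist}_G(1,i)\le\operatorname{dist}_G(1,j)$ whenever $i<j$. A sequence $(X_j)_{j\in\mathbb N}$ of subsets of a set $U$ \emph{converges pointwise} if for each $x\in U$ the truth value of $x\in X_j$ is eventually constant; its limit is the set of those $x$ that lie in $X_j$ for all but finitely many $j$. A sequence of BFS-labeled graphs $G_j$ \emph{converges} if the sequences $(V(G_j))_j$ and $(E(G_j))_j$ converge pointwise, and the \emph{limit graph} $\overline G$ is the graph whose vertex set and edge set are the respective limits. A graph is \emph{edge-transitive} if its automorphism group acts transitively on its unordered edges. A \emph{ray} is a one-way infinite path without repeated vertices; two rays are equivalent if for every finite set $S$ of vertices some connected component of $G-S$ contains all but finitely many vertices of each of the two rays; the \emph{ends} of $G$ are the equivalence classes of rays. A graph $H$ is a \emph{minor} of $G$ if there is a partition $\mathcal B$ of $V(G)$ into sets inducing connected subgraphs such that $H$ is isomorphic to a subgraph of the graph $G/\mathcal B$ (with vertex set $\mathcal B$, two distinct members being adjacent if $G$ has an edge between them), and the \emph{Hadwiger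 number} $\operatorname{Had}(G)$ is the largest $h\in\mathbb N$ such that the complete graph $K_h$ is a minor of $G$. \textbf{Theorem.} Let $d\in\mathbb N$ and let $(G_j)_{j\in\mathbb N}$ be a convergent sequence of finite connected BFS-labeled edge-transitive graphs, each of maximum degree at most $d$. If the limit graph $\overline G$ has more than two ends, then $\lim_{j\to\infty}\operatorname{Had}(G_j)=\infty$. -/

import Mathlib

open Filter

namespace SimpleGraph

variable {V W : Type*}

/-- `G` is edge-transitive: its automorphism group acts transitively on its (unordered) edges. -/
def IsEdgeTransitive (G : SimpleGraph V) : Prop :=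
  ∀ e ∈ G.edgeSet, ∀ e' ∈ G.edgeSet, ∃ σ : G ≃g G, e.map σ = e'

/-! ### Ends -/

/-- A ray: a one-way infinite path in which each vertex appears at most once. -/
structure Ray (G : SimpleGraph V) where
  /-- The `n`-th vertex of the ray. -/
  vert : ℕ → V
  injective : Function.Injective vert
  adj : ∀ n, G.Adj (vert n) (vert (n + 1))

/-- Two rays are equivalent if for every finite set `S` of vertices some connected component of
`G - S` contains all but finitely many vertices of each of the two rays. -/
def Ray.Equivalent {G : SimpleGraph V} (r r' : G.Ray) : Prop :=
  ∀ S : Set V, S.Finite → ∃ C : G.ComponentCompl S,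
    (∀ᶠ n in atTop, r.vert n ∈ C) ∧ (∀ᶠ n in atTop, r'.vert n ∈ C)

theorem Ray.Equivalent.refl {G : SimpleGraph V} (r : G.Ray) : r.Equivalent r := by
  intro S hS
  have h : ∀ᶠ n in atTop, r.vert n ∉ S := by
    have := r.injective.tendsto_cofinite.eventually hS.eventually_cofinite_notMem
    rwa [Nat.cofinite_eq_atTop] at this
  obtain ⟨N, hN⟩ := eventually_atTop.1 h
  have key : ∀ n ≥ N, r.vert n ∈ G.componentComplMk (hN N le_rfl) := by
    intro n hn
    induction n, hn using Nat.le_induction with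
    | base => exact ⟨hN N le_rfl, rfl⟩
    | succ n hn ih =>
      obtain ⟨_, h1⟩ := ih
      exact ⟨hN _ (by omega), (G.componentComplMk_eq_of_adj _ _ (r.adj n).symm).trans h1⟩
  exact ⟨_, eventually_atTop.2 ⟨N, key⟩, eventually_atTop.2 ⟨N, key⟩⟩

theorem Ray.Equivalent.trans {G : SimpleGraph V} {r r' r'' : G.Ray}
    (h : r.Equivalent r') (h' : r'.Equivalent r'') : r.Equivalent r'' := by
  intro S hS
  obtain ⟨C, h1, h2⟩ := h S hS
  obtain ⟨D, h3, h4⟩ := h' S hS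
  obtain ⟨n, hC, hD⟩ := (h2.and h3).exists
  obtain ⟨_, e1⟩ := hC
  obtain ⟨_, e2⟩ := hD
  have e : C = D := e1.symm.trans e2
  subst e
  exact ⟨C, h1, h4⟩

/-- Equivalence of rays, as a setoid. -/
def Ray.setoid (G : SimpleGraph V) : Setoid G.Ray where
  r := Ray.Equivalent
  iseqv := ⟨Ray.Equivalent.refl,
    fun h S hS => (h S hS).imp fun _ hC => hC.symm, Ray.Equivalent.trans⟩

/-- The ends of `G`: the equivalence classes of its rays. -/
def RayEnds (G : SimpleGraph V) : Type _ := Quotient (Ray.setoid G)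

/-! ### Minors and the Hadwiger number -/

/-- The graph `G / B` obtained by contracting the members of a family `B` of vertex sets. -/
def contract (G : SimpleGraph V) (B : Set (Set V)) : SimpleGraph B where
  Adj b b' := b ≠ b' ∧ ∃ v ∈ b.1, ∃ v' ∈ b'.1, G.Adj v v'
  symm := ⟨fun _ _ ⟨hne, v, hv, v', hv', h⟩ => ⟨hne.symm, v', hv', v, hv, h.symm⟩⟩
  loopless := ⟨fun _ h => h.1 rfl⟩

/-- `H` is a minor of `G`: the vertex set of `G` has a partition `B` into connected branch sets
such that `H` is isomorphic to a (not necessarily induced) subgraph of `G / B`. -/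
def IsMinorOf (H : SimpleGraph W) (G : SimpleGraph V) : Prop :=
  ∃ B : Set (Set V), Setoid.IsPartition B ∧ (∀ b ∈ B, (G.induce b).Connected) ∧
    H.IsContained (G.contract B)

/-- The Hadwiger number: the largest `h` such that `K_h` is a minor of `G`
(for finite `G` such a largest `h` exists). -/
noncomputable def hadwigerNumber (G : SimpleGraph V) : ℕ :=
  sSup {h : ℕ | (completeGraph (Fin h)).IsMinorOf G}

end SimpleGraph

/-! ### Pointwise limits of labeled graphs -/

/-- Pointwise convergence of a sequence of subsets. -/
def ConvergesPointwise {U : Type*} (X : ℕ → Set U) : Prop :=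
  ∀ x, ∃ n₀, ∀ n ≥ n₀, (x ∈ X n ↔ x ∈ X n₀)

/-- The pointwise limit: the elements belonging to all but finitely many of the sets. -/
def pointwiseLimit {U : Type*} (X : ℕ → Set U) : Set U :=
  {x | ∀ᶠ n in atTop, x ∈ X n}

/-- A graph whose vertex set is a set of natural numbers. The graph itself, on the type of its
vertices, is `G.coe`. -/
abbrev NatGraph : Type := (⊤ : SimpleGraph ℕ).Subgraph

namespace NatGraph

/-- `G` is BFS-labeled: its vertex set is `{1, …, n}` for some `n ≥ 1`, and vertices with smaller
labels are at most as far from the root `1` as vertices with larger labels. -/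
structure IsBFSLabeled (G : NatGraph) : Prop where
  verts_eq : ∃ n ≥ 1, G.verts = Set.Icc 1 n
  dist_le : ∀ root i j : G.verts, root.1 = 1 → i.1 < j.1 →
    G.coe.dist root i ≤ G.coe.dist root j

/-- A sequence of graphs converges if its vertex sets and its edge sets converge pointwise. -/
def Converges (G : ℕ → NatGraph) : Prop :=
  ConvergesPointwise (fun j => (G j).verts) ∧ ConvergesPointwise (fun j => (G j).edgeSet)

/-- The graph whose vertex set and edge set are the pointwise limits of those of the `G j`. -/
def limit (G : ℕ → NatGraph) : NatGraph where
  verts := pointwiseLimit fun j => (G j).verts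
  Adj u v := s(u, v) ∈ pointwiseLimit fun j => (G j).edgeSet
  adj_sub {u v} h := by
    obtain ⟨j, hj⟩ := Eventually.exists h
    exact (G j).adj_sub hj
  edge_vert {u v} h := Eventually.mono h fun j hj => (G j).edge_vert hj
  symm := ⟨fun u v h => by rwa [Sym2.eq_swap]⟩

end NatGraph

/-!
A finite graph `G` with a root `o` is compared with the limit only through the following local
property: removing the ball of radius `k` around `o` from the ball of radius `R` leaves at least `m`
components that reach the sphere of radius `R` (`SimpleGraph.HasBranches`).

*From the limit to the sequence.* Three pairwise inequivalent rays of the limit are separated by a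
finite set, which lies in a ball of some radius `r` around the root. By the BFS labeling and the
degree bound, the ball of radius `R` in any `G j` has labels at most `(d + 1) ^ R`, so for every
`R > r` the three rays yield three branches in `G j` as soon as `j` is large
(`NatGraph.Converges.eventually_hasBranches`).

*From three branches to many.* In an edge-transitive graph the orbit `O` of the root meets every
edge, and each vertex of `O` has the same branching as the root. Pick `x ∈ O` inside one of the
branches at `o`, beyond the ball used there. The ball around `o` is connected and misses the ball
around `x`, so it meets at most one of the three branches at `x`; the other two replace the branch
of `o` containing `x` (`SimpleGraph.HasBranches.succ`). Iterating, every vertex of `O` has as many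
branches as desired, with a radius `k` depending only on that number and on `r`. This is a finite
version of the argument that a quasi-transitive graph with three ends has infinitely many.

*From many branches to a clique minor.* Take a maximal subset `X` of `O` with pairwise distances
greater than `2 * k`, and contract its Voronoi cells. The cell of `c ∈ X` contains the ball of
radius `k` around `c` but does not reach the sphere of radius `6 * k + 4`. A neighbouring cell is
connected, avoids that ball and stays inside the sphere, so it meets only one branch at `c`. Hence
the contracted graph has minimum degree at least the number of branches
(`SimpleGraph.HasBranches.hasCliqueModel`), and Mader's theorem
(`SimpleGraph.hasCliqueModel_of_le_degreeSumIn`) gives a large clique minor.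
-/

namespace SimpleGraph

variable {V W : Type*} {G : SimpleGraph V}

/-! ### Reachability inside a vertex set, and geodesics -/

/-- `v` can be reached from `u` by a walk of `G` all of whose vertices, the endpoints included, lie
in `A`. -/
def ReachableIn (G : SimpleGraph V) (A : Set V) (u v : V) : Prop :=
  ∃ p : G.Walk u v, ∀ w ∈ p.support, w ∈ A

namespace ReachableIn

variable {A B : Set V} {u v w : V}

theorem refl (h : u ∈ A) : G.ReachableIn A u u := ⟨.nil, by simpa using h⟩

theorem symm (h : G.ReachableIn A u v) : G.ReachableIn A v u := by
  obtain ⟨p, hp⟩ := h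
  exact ⟨p.reverse, by simpa using hp⟩

theorem trans (h : G.ReachableIn A u v) (h' : G.ReachableIn A v w) : G.ReachableIn A u w := by
  obtain ⟨p, hp⟩ := h
  obtain ⟨q, hq⟩ := h'
  refine ⟨p.append q, fun x hx => ?_⟩
  rcases (Walk.mem_support_append_iff _ _).1 hx with hx | hx
  exacts [hp x hx, hq x hx]

theorem mono (hAB : A ⊆ B) (h : G.ReachableIn A u v) : G.ReachableIn B u v := by
  obtain ⟨p, hp⟩ := h
  exact ⟨p, fun x hx => hAB (hp x hx)⟩

theorem of_adj (h : G.Adj u v) (hu : u ∈ A) (hv : v ∈ A) : G.ReachableIn A u v := by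
  refine ⟨h.toWalk, fun x hx => ?_⟩
  have : x = u ∨ x = v := by simpa using hx
  rcases this with rfl | rfl <;> assumption

/-- The vertices of a sequence of successively adjacent vertices in `A` reach each other in `A`. -/
theorem of_sequence {γ : ℕ → V} {a b : ℕ} (hab : a ≤ b)
    (hadj : ∀ i, a ≤ i → i < b → G.Adj (γ i) (γ (i + 1)))
    (hA : ∀ i, a ≤ i → i ≤ b → γ i ∈ A) : G.ReachableIn A (γ a) (γ b) := by
  induction b, hab using Nat.le_induction with
  | base => exact refl (hA a le_rfl le_rfl)
  | succ b hb ih =>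
    exact (ih (fun i h h' => hadj i h (by omega)) (fun i h h' => hA i h (by omega))).trans
      (of_adj (hadj b hb (by omega)) (hA b hb (by omega)) (hA _ (by omega) le_rfl))

theorem map_iso {G' : SimpleGraph W} (σ : G ≃g G') {B : Set W} (h : ∀ a ∈ A, σ a ∈ B)
    (huv : G.ReachableIn A u v) : G'.ReachableIn B (σ u) (σ v) := by
  obtain ⟨p, hp⟩ := huv
  refine ⟨p.map σ.toHom, fun x hx => ?_⟩
  rw [Walk.support_map, List.mem_map] at hx
  obtain ⟨a, ha, rfl⟩ := hx
  exact h a (hp a ha)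

end ReachableIn

/-- The vertex sets that induce connected subgraphs, described by walks of the ambient graph. -/
def IsConnectedSet (G : SimpleGraph V) (A : Set V) : Prop :=
  A.Nonempty ∧ ∀ u ∈ A, ∀ v ∈ A, G.ReachableIn A u v

theorem IsConnectedSet.induce_connected {A : Set V} (h : G.IsConnectedSet A) :
    (G.induce A).Connected := by
  have := h.1.to_subtype
  refine ⟨fun u v => ?_⟩
  obtain ⟨p, hp⟩ := h.2 u u.2 v v.2
  exact ⟨p.induce A hp⟩

theorem isConnectedSet_singleton (v : V) : G.IsConnectedSet {v} :=
  ⟨⟨v, rfl⟩, by rintro _ rfl _ rfl; exact ReachableIn.refl rfl⟩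

theorem IsConnectedSet.insert {A : Set V} (h : G.IsConnectedSet A) {a v : V} (ha : a ∈ A)
    (hav : G.Adj a v) : G.IsConnectedSet (insert v A) := by
  have key : ∀ u ∈ Insert.insert v A, G.ReachableIn (Insert.insert v A) u a := by
    rintro u (rfl | hu)
    · exact ReachableIn.of_adj hav.symm (by simp) (by simp [ha])
    · exact (h.2 u hu a ha).mono (Set.subset_insert _ _)
  exact ⟨⟨v, by simp⟩, fun u hu w hw => (key u hu).trans (key w hw).symm⟩

/-- A geodesic from `x` to `y`, as a sequence; its values beyond `G.dist x y` are irrelevant. -/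
theorem Connected.exists_geodesic (hG : G.Connected) (x y : V) :
    ∃ γ : ℕ → V, γ 0 = x ∧ γ (G.dist x y) = y ∧
      (∀ i < G.dist x y, G.Adj (γ i) (γ (i + 1))) ∧ ∀ i ≤ G.dist x y, G.dist x (γ i) = i := by
  obtain ⟨p, hp⟩ := hG.exists_walk_length_eq_dist x y
  refine ⟨p.getVert, by simp, by simp [← hp], fun i hi => p.adj_getVert_succ (by omega),
    fun i hi => ?_⟩
  have h1 : G.dist x (p.getVert i) ≤ i := by
    have := dist_le (p.take i)
    rw [Walk.take_length] at this
    omega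
  have h2 : G.dist (p.getVert i) y ≤ p.length - i := by
    have := dist_le (p.drop i)
    rwa [Walk.drop_length] at this
  have := hG.dist_triangle (u := x) (v := p.getVert i) (w := y)
  omega

theorem Connected.dist_le_of_sequence (hG : G.Connected) {γ : ℕ → V} {a b : ℕ} (hab : a ≤ b)
    (hadj : ∀ i, a ≤ i → i < b → G.Adj (γ i) (γ (i + 1))) : G.dist (γ a) (γ b) ≤ b - a := by
  induction b, hab using Nat.le_induction with
  | base => simp
  | succ b hb ih =>
    have h1 := ih fun i h h' => hadj i h (by omega)
    have h2 := dist_eq_one_iff_adj.2 (hadj b hb (by omega))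
    have h3 := hG.dist_triangle (u := γ a) (v := γ b) (w := γ (b + 1))
    omega

theorem Connected.dist_iso_le {G' : SimpleGraph W} (hG : G.Connected) (σ : G ≃g G') (u v : V) :
    G'.dist (σ u) (σ v) ≤ G.dist u v := by
  obtain ⟨p, hp⟩ := hG.exists_walk_length_eq_dist u v
  rw [← hp, ← Walk.length_map σ.toHom p]
  exact dist_le _

theorem Connected.dist_iso (hG : G.Connected) (σ : G ≃g G) (u v : V) :
    G.dist (σ u) (σ v) = G.dist u v := by
  refine (hG.dist_iso_le σ u v).antisymm ?_
  simpa using hG.dist_iso_le σ.symm (σ u) (σ v)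

/-! ### Clique minors of dense graphs -/

/-- A model of `K_h` in `G` with branch sets inside `U`: pairwise disjoint connected vertex sets,
any two of which are joined by an edge. The branch sets need not cover the graph. -/
def HasCliqueModel (G : SimpleGraph V) (U : Set V) (h : ℕ) : Prop :=
  ∃ A : Fin h → Set V, (∀ i, A i ⊆ U) ∧ (∀ i, G.IsConnectedSet (A i)) ∧
    ∀ i j, i ≠ j → Disjoint (A i) (A j) ∧ ∃ a ∈ A i, ∃ b ∈ A j, G.Adj a b

/-- The branch sets of a clique model, together with singletons for the remaining vertices, form a
partition into connected sets. -/
theorem HasCliqueModel.isMinorOf {U : Set V} {h : ℕ} (hG : G.HasCliqueModel U h) :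
    (completeGraph (Fin h)).IsMinorOf G := by
  obtain ⟨A, -, hA, hAA⟩ := hG
  have hinj : Function.Injective A := by
    intro i j hij
    by_contra hne
    have := (hAA i j hne).1
    rw [hij, disjoint_self] at this
    exact (hA j).1.ne_empty this
  refine ⟨Set.range A ∪ {b | ∃ v, (∀ i, v ∉ A i) ∧ b = {v}}, ⟨?_, fun v => ?_⟩, ?_, ?_⟩
  · rintro (⟨i, hi⟩ | ⟨v, -, hv⟩)
    · exact (hA i).1.ne_empty hi
    · exact Set.singleton_ne_empty v hv.symm
  · by_cases hv : ∃ i, v ∈ A i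
    · obtain ⟨i, hi⟩ := hv
      refine ⟨A i, ⟨Or.inl ⟨i, rfl⟩, hi⟩, ?_⟩
      rintro _ ⟨⟨j, rfl⟩ | ⟨w, hw, rfl⟩, hj⟩
      · by_contra hne
        exact Set.disjoint_left.1 (hAA j i fun h => hne (h ▸ rfl)).1 hj hi
      · obtain rfl : v = w := hj
        exact absurd hi (hw i)
    · push Not at hv
      refine ⟨{v}, ⟨Or.inr ⟨v, hv, rfl⟩, rfl⟩, ?_⟩
      rintro _ ⟨⟨j, rfl⟩ | ⟨w, hw, rfl⟩, hj⟩
      · exact absurd hj (hv j)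
      · obtain rfl : v = w := hj
        rfl
  · rintro _ (⟨i, rfl⟩ | ⟨v, -, rfl⟩)
    · exact (hA i).induce_connected
    · exact (isConnectedSet_singleton v).induce_connected
  · refine ⟨⟨⟨fun i => ⟨A i, Or.inl ⟨i, rfl⟩⟩, fun {i j} hij => ⟨?_, ?_⟩⟩, fun i j hij => ?_⟩⟩
    · intro h
      exact hij (hinj (congrArg Subtype.val h))
    · exact (hAA i j hij).2
    · exact hinj (congrArg Subtype.val hij)

theorem HasCliqueModel.le_hadwigerNumber [Finite V] {U : Set V} {h : ℕ}
    (hG : G.HasCliqueModel U h) : h ≤ G.hadwigerNumber := by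
  refine le_csSup ⟨Nat.card (Set V), ?_⟩ hG.isMinorOf
  rintro k ⟨B, -, -, ⟨f⟩⟩
  have := Nat.card_le_card_of_injective (fun i => (f i : Set V))
    (Subtype.val_injective.comp f.injective)
  simpa using this

/-- Clique models pull back along a map with connected fibers. -/
theorem HasCliqueModel.of_fibers {Q : SimpleGraph W} {f : V → W} {U : Set W} {h : ℕ}
    (hf : ∀ c ∈ U, G.IsConnectedSet (f ⁻¹' {c}))
    (hQ : ∀ c c', Q.Adj c c' → ∃ u v, f u = c ∧ f v = c' ∧ G.Adj u v)
    (hU : Q.HasCliqueModel U h) : G.HasCliqueModel Set.univ h := by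
  obtain ⟨A, hAU, hA, hAA⟩ := hU
  have lift : ∀ i c c', ∀ p : Q.Walk c c', (∀ w ∈ p.support, w ∈ A i) → ∀ u v, f u = c → f v = c' →
      G.ReachableIn (f ⁻¹' A i) u v := by
    intro i c c' p
    have fiber : ∀ u v, f u ∈ A i → f u = f v → G.ReachableIn (f ⁻¹' A i) u v := fun u v hu huv =>
      ((hf _ (hAU i hu)).2 u rfl v huv.symm).mono fun w hw => by
        rw [Set.mem_preimage, show f w = f u from hw]; exact hu
    induction p with
    | nil =>
      rintro hp u v rfl huv
      exact fiber u v (hp _ (by simp)) huv.symm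
    | cons hadj p ih =>
      rintro hp u v rfl hv
      obtain ⟨a, b, ha, hb, hab⟩ := hQ _ _ hadj
      have hu : f u ∈ A i := hp _ (by simp)
      have hbA : f b ∈ A i := hb ▸ hp _ (by simp)
      refine (fiber u a hu ha.symm).trans ((ReachableIn.of_adj hab ?_ hbA).trans
        (ih (fun w hw => hp w (by simp [hw])) b v hb hv))
      rw [Set.mem_preimage, ha]; exact hu
  refine ⟨fun i => f ⁻¹' A i, fun i => Set.subset_univ _, fun i => ⟨?_, ?_⟩,
    fun i j hij => ⟨?_, ?_⟩⟩
  · obtain ⟨c, hc⟩ := (hA i).1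
    obtain ⟨v, hv⟩ := (hf c (hAU i hc)).1
    exact ⟨v, by rw [Set.mem_preimage, show f v = c from hv]; exact hc⟩
  · intro u hu v hv
    obtain ⟨p, hp⟩ := (hA i).2 (f u) hu (f v) hv
    exact lift i _ _ p hp u v rfl rfl
  · exact (hAA i j hij).1.preimage f
  · obtain ⟨c, hc, c', hc', hcc⟩ := (hAA i j hij).2
    obtain ⟨u, v, rfl, rfl, huv⟩ := hQ _ _ hcc
    exact ⟨u, hc, v, hc', huv⟩

open scoped Classical in
/-- Twice the number of edges of `G` inside `U`, as the sum of the degrees in the subgraph induced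
on `U`. -/
noncomputable def degreeSumIn (G : SimpleGraph V) (U : Finset V) : ℕ :=
  ∑ u ∈ U, (U.filter (G.Adj u)).card

open scoped Classical in
theorem le_degreeSumIn {U : Finset V} {c : ℕ} (h : ∀ u ∈ U, c ≤ (U.filter (G.Adj u)).card) :
    c * U.card ≤ G.degreeSumIn U := by
  rw [mul_comm, ← smul_eq_mul]
  exact Finset.card_nsmul_le_sum _ _ _ h

open scoped Classical in
theorem degreeSumIn_erase (U : Finset V) {v : V} (hv : v ∈ U) :
    G.degreeSumIn U = G.degreeSumIn (U.erase v) + 2 * (U.filter (G.Adj v)).card := by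
  obtain ⟨T, hT, rfl⟩ : ∃ T, v ∉ T ∧ U = insert v T :=
    ⟨U.erase v, by simp, (Finset.insert_erase hv).symm⟩
  rw [Finset.erase_insert hT]
  unfold degreeSumIn
  have h1 : ∀ u ∈ T, ((insert v T).filter (G.Adj u)).card =
      (T.filter (G.Adj u)).card + if G.Adj v u then 1 else 0 := by
    intro u hu
    rw [Finset.filter_insert]
    by_cases h : G.Adj u v
    · rw [if_pos h, if_pos h.symm, Finset.card_insert_of_notMem (by simp [hT])]
    · rw [if_neg h, if_neg fun h' => h h'.symm, add_zero]
  rw [Finset.sum_insert hT, Finset.sum_congr rfl h1, Finset.sum_add_distrib, Finset.filter_insert,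
    if_neg (G.loopless.irrefl v), Finset.card_filter (fun u => G.Adj v u)]
  ring

open scoped Classical in
/-- **Mader's theorem**: a graph with at least `2 ^ h` times as many edges as vertices has a `K_h`
minor (`degreeSumIn` counts every edge twice). Contract a maximal connected set `X` such that the
contracted graph still has this edge density. By maximality every edge from `X` lies in many
triangles of the contracted graph, so the neighbourhood of `X` has large minimum degree; a clique
model found there by induction is extended by the branch set `X`. -/
theorem hasCliqueModel_of_le_degreeSumIn (h : ℕ) : ∀ U : Finset V, U.Nonempty →
    2 * 2 ^ h * U.card ≤ G.degreeSumIn U → G.HasCliqueModel U h := by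
  induction h with
  | zero => exact fun U _ _ => ⟨fun i => i.elim0, fun i => i.elim0, fun i => i.elim0,
      fun i => i.elim0⟩
  | succ h ihh =>
    intro U
    induction U using Finset.strongInduction with
    | H U ihU =>
    intro hU hdeg
    set c : ℕ := 2 ^ (h + 1) with hc
    have hcpos : 0 < c := by positivity
    -- the part of `U \ X` adjacent to `X`
    let N : Finset V → Finset V := fun X => (U \ X).filter fun v => ∃ x ∈ X, G.Adj x v
    -- contracting `X` in `U` leaves at least `c` times as many edges as vertices
    let good : Finset V → Prop := fun X => X ⊆ U ∧ G.IsConnectedSet X ∧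
      2 * c * ((U \ X).card + 1) ≤ G.degreeSumIn (U \ X) + 2 * (N X).card
    have hne : (U.powerset.filter good).Nonempty := by
      obtain ⟨v, hv⟩ := hU
      refine ⟨{v}, Finset.mem_filter.2 ⟨by simpa using hv, by simpa using hv,
        by simpa using isConnectedSet_singleton v, ?_⟩⟩
      have h1 : N {v} = U.filter (G.Adj v) := by
        ext w
        simp only [N, Finset.mem_filter, Finset.mem_sdiff, Finset.mem_singleton, exists_eq_left]
        exact ⟨fun h => ⟨h.1.1, h.2⟩, fun h => ⟨⟨h.1, fun e => G.loopless.irrefl v (e ▸ h.2)⟩, h.2⟩⟩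
      rw [h1, Finset.sdiff_singleton_eq_erase, ← degreeSumIn_erase U hv,
        Finset.card_erase_add_one hv]
      exact hdeg
    obtain ⟨X, hX, hmax⟩ := Finset.exists_max_image _ Finset.card hne
    obtain ⟨-, hXU, hXc, hXd⟩ := Finset.mem_filter.1 hX
    have hXne : X.Nonempty := by simpa using hXc.1
    by_cases hN : (N X).Nonempty
    · have hmin : ∀ v ∈ N X, c ≤ ((N X).filter (G.Adj v)).card := by
        intro v hv
        obtain ⟨hvUX, x, hx, hxv⟩ := Finset.mem_filter.1 hv
        obtain ⟨hvU, hvX⟩ := Finset.mem_sdiff.1 hvUX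
        have hbad : ¬ good (insert v X) := fun hg => by
          have := hmax (insert v X) (Finset.mem_filter.2 ⟨Finset.mem_powerset.2 hg.1, hg⟩)
          rw [Finset.card_insert_of_notMem hvX] at this
          omega
        have hins : U \ insert v X = (U \ X).erase v := by
          ext w; simp only [Finset.mem_sdiff, Finset.mem_insert, Finset.mem_erase]; tauto
        have hlt : G.degreeSumIn ((U \ X).erase v) + 2 * (N (insert v X)).card
            < 2 * c * (U \ X).card := by
          by_contra hge
          refine hbad ⟨Finset.insert_subset hvU hXU, ?_, ?_⟩
          · rw [Finset.coe_insert]; exact hXc.insert hx hxv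
          · rw [hins, Finset.card_erase_add_one hvUX]; omega
        have herase := degreeSumIn_erase (G := G) (U \ X) hvUX
        have hcard : (N X).card + ((U \ X).filter (G.Adj v)).card ≤
            (N (insert v X)).card + 1 + ((N X).filter (G.Adj v)).card := by
          have e1 : (N X ∪ (U \ X).filter (G.Adj v)) ⊆ insert v (N (insert v X)) := by
            intro w hw
            simp only [N, Finset.mem_union, Finset.mem_filter, Finset.mem_sdiff, Finset.mem_insert,
              exists_eq_or_imp] at hw ⊢
            by_cases hwv : w = v
            · exact Or.inl hwv
            · right
              rcases hw with ⟨⟨h1, h2⟩, h3⟩ | ⟨⟨h1, h2⟩, h3⟩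
              · exact ⟨⟨h1, by tauto⟩, Or.inr h3⟩
              · exact ⟨⟨h1, by tauto⟩, Or.inl h3⟩
          have e2 : N X ∩ (U \ X).filter (G.Adj v) = (N X).filter (G.Adj v) := by
            ext w
            simp only [N, Finset.mem_inter, Finset.mem_filter]
            tauto
          have e3 := Finset.card_union_add_card_inter (N X) ((U \ X).filter (G.Adj v))
          have e4 := (Finset.card_le_card e1).trans (Finset.card_insert_le _ _)
          rw [e2] at e3
          omega
        have : 2 * c * ((U \ X).card + 1) = 2 * c * (U \ X).card + 2 * c := by ring
        omega
      obtain ⟨A, hAN, hA, hAA⟩ := ihh (N X) hN (by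
        rw [show 2 * 2 ^ h = c by rw [hc]; ring]
        exact le_degreeSumIn hmin)
      have hXA : ∀ i, Disjoint (X : Set V) (A i) := fun i => Set.disjoint_left.2 fun w hw hwA =>
        (Finset.mem_sdiff.1 (Finset.mem_filter.1 (hAN i hwA)).1).2 hw
      have hXadj : ∀ i, ∃ x ∈ (X : Set V), ∃ b ∈ A i, G.Adj x b := fun i => by
        obtain ⟨b, hb⟩ := (hA i).1
        obtain ⟨x, hx, hxb⟩ := (Finset.mem_filter.1 (hAN i hb)).2
        exact ⟨x, hx, b, hb, hxb⟩
      refine ⟨Fin.cons (X : Set V) A, ?_, ?_, ?_⟩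
      · refine Fin.cases hXU fun i w hw => ?_
        exact (Finset.mem_sdiff.1 (Finset.mem_filter.1 (hAN i hw)).1).1
      · exact Fin.cases hXc hA
      · intro i j
        refine Fin.cases ?_ (fun i => ?_) i <;> refine Fin.cases ?_ (fun j => ?_) j
        · exact fun h => absurd rfl h
        · exact fun _ => ⟨hXA j, hXadj j⟩
        · intro _
          obtain ⟨x, hx, b, hb, hxb⟩ := hXadj i
          exact ⟨(hXA i).symm, b, hb, x, hx, hxb.symm⟩
        · intro hij
          exact hAA i j fun e => hij (e ▸ rfl)
    · -- then `U \ X` is itself dense enough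
      rw [Finset.not_nonempty_iff_eq_empty] at hN
      rw [hN, Finset.card_empty, mul_zero, add_zero] at hXd
      have hUX : (U \ X).Nonempty := by
        rw [Finset.nonempty_iff_ne_empty]
        intro he
        rw [he] at hXd
        simp [degreeSumIn] at hXd
        omega
      obtain ⟨A, hAU, hA⟩ := ihU (U \ X) (Finset.sdiff_ssubset hXU hXne) hUX
        (le_trans (Nat.mul_le_mul_left _ (Nat.le_succ _)) hXd)
      exact ⟨A, fun i => (hAU i).trans (by simp), hA⟩

/-! ### Branches around a ball -/

/-- The vertices at distance greater than `k` and at most `R` from `o`. -/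
def shell (G : SimpleGraph V) (o : V) (k R : ℕ) : Set V :=
  {w | k < G.dist o w ∧ G.dist o w ≤ R}

/-- Removing the ball of radius `k` around `o` from the ball of radius `R` around `o` leaves at
least `m` components that contain vertices at distance exactly `R` from `o`. This is a finite, local
substitute for the statement that removing the ball of radius `k` leaves `m` infinite components. It
is meaningful only for `k < R`. -/
def HasBranches (G : SimpleGraph V) (o : V) (m k R : ℕ) : Prop :=
  ∃ s : Finset V, m ≤ s.card ∧ (∀ v ∈ s, G.dist o v = R) ∧
    (s : Set V).Pairwise fun v w => ¬ G.ReachableIn (G.shell o k R) v w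

open scoped Classical in
theorem HasBranches.map_iso {o : V} {m k R : ℕ} (hG : G.Connected) (σ : G ≃g G)
    (h : G.HasBranches o m k R) : G.HasBranches (σ o) m k R := by
  obtain ⟨s, hm, hd, hs⟩ := h
  refine ⟨s.image σ, by rwa [Finset.card_image_of_injective _ σ.injective], ?_, ?_⟩
  · intro v hv
    obtain ⟨u, hu, rfl⟩ := Finset.mem_image.1 hv
    rw [hG.dist_iso, hd u hu]
  · intro v hv w hw hvw hr
    obtain ⟨a, ha, rfl⟩ := Finset.mem_image.1 hv
    obtain ⟨b, hb, rfl⟩ := Finset.mem_image.1 hw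
    refine hs ha hb (fun e => hvw (e ▸ rfl)) ?_
    simpa using hr.map_iso σ.symm (B := G.shell o k R) fun x hx => by
      have := hG.dist_iso σ o (σ.symm x)
      rw [σ.apply_symm_apply] at this
      simpa only [shell, Set.mem_ofPred_eq, this] using hx

/-- A vertex beyond the sphere of radius `R` around `o` is reached, along a geodesic from a vertex
`x` inside that sphere, through a vertex on the sphere. -/
theorem Connected.exists_dist_eq_reachableIn_shell (hG : G.Connected) {o x w : V} {r R : ℕ}
    (hx : G.dist o x + r < R) (hw : R ≤ G.dist o w) :
    ∃ w', G.dist o w' = R ∧ G.ReachableIn (G.shell x r (G.dist x w)) w' w := by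
  classical
  obtain ⟨γ, h0, hn, hadj, hdist⟩ := hG.exists_geodesic x w
  have hex : ∃ i, R ≤ G.dist o (γ i) := ⟨_, hn.symm ▸ hw⟩
  have hspec := Nat.find_spec hex
  have hmin := fun i => Nat.find_min hex (m := i)
  have hle : Nat.find hex ≤ G.dist x w := Nat.find_min' hex (hn.symm ▸ hw)
  generalize Nat.find hex = i at hspec hmin hle
  have hi : i ≠ 0 := by
    rintro rfl
    rw [h0] at hspec
    omega
  obtain ⟨i, rfl⟩ := Nat.exists_eq_succ_of_ne_zero hi
  have h1 := hmin i (Nat.lt_succ_self i)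
  have h2 := hG.dist_triangle (u := o) (v := γ i) (w := γ (i + 1))
  have h3 := dist_eq_one_iff_adj.2 (hadj i hle)
  have h4 := hG.dist_triangle (u := o) (v := x) (w := γ (i + 1))
  have h5 := hdist _ hle
  refine ⟨γ (i + 1), by simp only [Nat.succ_eq_add_one] at hspec; omega, ?_⟩
  have h6 := ReachableIn.of_sequence (A := G.shell x r (G.dist x w)) (γ := γ) (a := i + 1) hle
    (fun j _ hj => hadj j hj) (fun j hj hj' => by
      have := hdist j hj'
      simp only [Nat.succ_eq_add_one] at *
      constructor <;> omega)
  rwa [hn] at h6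

/-- Branching at a vertex `x` inside one of the branches at `o` increases the number of branches:
the ball around `o` lies in at most one of the three branches at `x`, and the other two replace the
branch of `o` that contains `x`. -/
theorem HasBranches.succ (hG : G.Connected) {o x v₁ : V} {s : Finset V} {m k r k' R R₂ : ℕ}
    (hm : m ≤ s.card) (hsR : ∀ v ∈ s, G.dist o v = R)
    (hs : (s : Set V).Pairwise fun v w => ¬ G.ReachableIn (G.shell o k R) v w)
    (hv₁ : v₁ ∈ s) (hxv₁ : G.ReachableIn (G.shell o k R) x v₁) (hfar : k + r < G.dist o x)
    (hk' : G.dist o x + r ≤ k') (hR : k' < R) (hR₂ : R + G.dist o x ≤ R₂)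
    (hx : G.HasBranches x 3 r R₂) : G.HasBranches o (m + 1) k' R := by
  classical
  obtain ⟨t, ht, htR, hts⟩ := hx
  have hself : ∀ v, G.dist o v = R → v ∈ G.shell o k' R := fun v hv => ⟨hv ▸ hR, hv.le⟩
  have hsub : G.shell o k' R ⊆ G.shell x r R₂ := fun z hz => by
    have h1 := hG.dist_triangle (u := o) (v := x) (w := z)
    have h2 := hG.dist_triangle (u := x) (v := o) (w := z)
    rw [dist_comm (u := x) (v := o)] at h2
    obtain ⟨h3, h4⟩ := hz
    constructor <;> omega
  have hsub' : G.shell o k' R ⊆ G.shell o k R := fun z hz => ⟨by have := hz.1; omega, hz.2⟩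
  -- the other branches at `o` are joined to `o` outside the ball around `x`
  have hback : ∀ v ∈ s, v ≠ v₁ → G.ReachableIn (G.shell x r R₂) v o := by
    intro v hv hne
    obtain ⟨γ, h0, hn, hadj, hdist⟩ := hG.exists_geodesic o v
    rw [hsR v hv] at hn hadj hdist
    have hA : ∀ i, 0 ≤ i → i ≤ R → γ i ∈ G.shell x r R₂ := by
      intro i _ hi
      have h2 := hG.dist_triangle (u := x) (v := o) (w := γ i)
      rw [dist_comm (u := x) (v := o), hdist i hi] at h2
      refine ⟨?_, by omega⟩
      -- otherwise the ball around `x` joins `v` to the branch of `v₁`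
      by_contra hlt
      push Not at hlt
      obtain ⟨δ, e0, en, eadj, edist⟩ := hG.exists_geodesic x (γ i)
      have hδ : ∀ j ≤ G.dist x (γ i), k < G.dist o (δ j) ∧ G.dist o (δ j) ≤ R := by
        intro j hj
        have h3 := hG.dist_triangle (u := o) (v := x) (w := δ j)
        have h4 := hG.dist_triangle (u := o) (v := δ j) (w := x)
        rw [dist_comm (u := δ j) (v := x)] at h4
        rw [edist j hj] at h3 h4
        constructor <;> omega
      have h5 := ReachableIn.of_sequence (A := G.shell o k R) (Nat.zero_le _)
        (fun j _ hj => eadj j hj) (fun j _ hj => hδ j hj)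
      rw [e0, en] at h5
      have hki : k < i := by
        have := (hδ _ le_rfl).1
        rwa [en, hdist i hi] at this
      have h6 := ReachableIn.of_sequence (A := G.shell o k R) hi (fun j _ hj => hadj j hj)
        (fun j hj hj' => by constructor <;> rw [hdist j hj'] <;> omega)
      rw [hn] at h6
      exact hs hv hv₁ hne (h6.symm.trans (h5.symm.trans hxv₁))
    have := ReachableIn.of_sequence (Nat.zero_le R) (fun i _ hi => hadj i hi) hA
    rw [h0, hn] at this
    exact this.symm
  have hout : ∀ w ∈ t, ∃ w', G.dist o w' = R ∧ G.ReachableIn (G.shell x r R₂) w' w := by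
    intro w hw
    have h1 := hG.dist_triangle (u := x) (v := o) (w := w)
    rw [dist_comm (u := x) (v := o), htR w hw] at h1
    have := hG.exists_dist_eq_reachableIn_shell (o := o) (x := x) (w := w) (r := r) (R := R)
      (by omega) (by omega)
    rwa [htR w hw] at this
  -- at most one branch at `x` contains `o`
  have hone : (t.filter fun w => G.ReachableIn (G.shell x r R₂) w o).card ≤ 1 := by
    rw [Finset.card_le_one]
    intro a ha b hb
    rw [Finset.mem_filter] at ha hb
    by_contra hab
    exact hts ha.1 hb.1 hab (ha.2.trans hb.2.symm)
  have htwo : 1 < (t.filter fun w => ¬ G.ReachableIn (G.shell x r R₂) w o).card := by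
    have := Finset.card_filter_add_card_filter_not (s := t)
      (fun w => G.ReachableIn (G.shell x r R₂) w o)
    omega
  obtain ⟨a, ha, b, hb, hab⟩ := Finset.one_lt_card.1 htwo
  rw [Finset.mem_filter] at ha hb
  obtain ⟨a', haR, haa⟩ := hout a ha.1
  obtain ⟨b', hbR, hbb⟩ := hout b hb.1
  have hab' : ¬ G.ReachableIn (G.shell o k' R) a' b' := fun h =>
    hts ha.1 hb.1 hab (haa.symm.trans ((h.mono hsub).trans hbb))
  have hav : ∀ v ∈ s.erase v₁, ¬ G.ReachableIn (G.shell o k' R) a' v := fun v hv h =>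
    ha.2 (haa.symm.trans ((h.mono hsub).trans
      (hback v (Finset.mem_of_mem_erase hv) (Finset.ne_of_mem_erase hv))))
  have hbv : ∀ v ∈ s.erase v₁, ¬ G.ReachableIn (G.shell o k' R) b' v := fun v hv h =>
    hb.2 (hbb.symm.trans ((h.mono hsub).trans
      (hback v (Finset.mem_of_mem_erase hv) (Finset.ne_of_mem_erase hv))))
  have hb1 : b' ∉ s.erase v₁ := fun h => hbv b' h (.refl (hself _ hbR))
  have ha1 : a' ∉ insert b' (s.erase v₁) := fun h => by
    rcases Finset.mem_insert.1 h with h | h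
    · exact hab' (h ▸ .refl (hself _ haR))
    · exact hav a' h (.refl (hself _ haR))
  have hsymm : Std.Symm fun v w => ¬ G.ReachableIn (G.shell o k' R) v w :=
    ⟨fun _ _ h h' => h h'.symm⟩
  refine ⟨insert a' (insert b' (s.erase v₁)), ?_, ?_, ?_⟩
  · rw [Finset.card_insert_of_notMem ha1, Finset.card_insert_of_notMem hb1,
      Finset.card_erase_of_mem hv₁]
    omega
  · intro v hv
    rcases Finset.mem_insert.1 hv with rfl | hv
    · exact haR
    rcases Finset.mem_insert.1 hv with rfl | hv
    · exact hbR
    exact hsR v (Finset.mem_of_mem_erase hv)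
  · rw [Finset.coe_insert, Finset.coe_insert, Set.pairwise_insert_of_symm,
      Set.pairwise_insert_of_symm]
    refine ⟨⟨fun v hv w hw hvw h => hs (Finset.mem_of_mem_erase hv) (Finset.mem_of_mem_erase hw) hvw
      (h.mono hsub'), fun v hv _ => hbv v hv⟩, ?_⟩
    rintro v (rfl | hv) _
    exacts [hab', hav v hv]

/-- If every vertex of a set `O` that meets every edge branches into three, then the vertices of `O`
branch into arbitrarily many. The constants depend only on the radius `r`
and on the required number of branches. -/
theorem exists_hasBranches_add (r n : ℕ) : ∃ k c : ℕ, r ≤ k ∧ ∀ (V : Type*) (G : SimpleGraph V)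
    (O : Set V), G.Connected → (∀ u v, G.Adj u v → u ∈ O ∨ v ∈ O) → ∀ R, k < R →
    (∀ x ∈ O, ∀ R', r < R' → R' ≤ R + c → G.HasBranches x 3 r R') →
    ∀ o ∈ O, G.HasBranches o (3 + n) k R := by
  induction n with
  | zero => exact ⟨r, 0, le_rfl, fun V G O _ _ R hR h o ho => h o ho R hR (by omega)⟩
  | succ n ih =>
    obtain ⟨k, c, hrk, ih⟩ := ih
    refine ⟨k + 2 * r + 2, c + k + r + 2, by omega, fun V G O hG hO R hR h o ho => ?_⟩
    obtain ⟨s, hm, hsR, hs⟩ := ih V G O hG hO R (by omega)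
      (fun x hx R' h1 h2 => h x hx R' h1 (by omega)) o ho
    obtain ⟨v₁, hv₁⟩ : s.Nonempty := Finset.card_pos.1 (by omega)
    obtain ⟨γ, -, hn, hadj, hdist⟩ := hG.exists_geodesic o v₁
    rw [hsR v₁ hv₁] at hn hadj hdist
    -- at distance `k + r + 1` the ball of radius `r` misses the ball of radius `k` around `o`;
    -- one more step may be needed to land in `O`
    obtain ⟨a, ha1, ha2, haO⟩ : ∃ a, k + r + 1 ≤ a ∧ a ≤ k + r + 2 ∧ γ a ∈ O := by
      rcases hO _ _ (hadj (k + r + 1) (by omega)) with h | h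
      exacts [⟨_, le_rfl, by omega, h⟩, ⟨_, by omega, le_rfl, h⟩]
    have hda := hdist a (by omega)
    have hreach := ReachableIn.of_sequence (A := G.shell o k R) (show a ≤ R by omega)
      (fun j _ hj => hadj j hj)
      (fun j hj hj' => by constructor <;> rw [hdist j hj'] <;> omega)
    rw [hn] at hreach
    exact HasBranches.succ hG hm hsR hs hv₁ hreach (r := r) (R₂ := R + a) (by omega) (by omega) hR
      (by omega) (h _ haO _ (by omega) (by omega))

/-! ### Contracting Voronoi cells -/

/-- Voronoi cells: every vertex can be assigned to a nearest element of `X` in such a way that the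
cells are connected. -/
theorem Connected.exists_voronoi [Finite V] (hG : G.Connected) {X : Finset V} (hX : X.Nonempty) :
    ∃ f : V → V, (∀ v, f v ∈ X) ∧ (∀ v, ∀ c ∈ X, G.dist v (f v) ≤ G.dist v c) ∧
      ∀ c ∈ X, G.IsConnectedSet (f ⁻¹' {c}) := by
  obtain ⟨N, ⟨e⟩⟩ := Finite.exists_equiv_fin V
  -- ties between nearest elements of `X` are broken by a fixed enumeration
  have hmin : ∀ v, ∃ c ∈ X, ∀ c' ∈ X, toLex (G.dist v c, e c) ≤ toLex (G.dist v c', e c') :=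
    fun v => Finset.exists_min_image X (fun c => toLex (G.dist v c, e c)) hX
  choose f hfX hf using hmin
  have hle : ∀ v, ∀ c ∈ X, G.dist v (f v) < G.dist v c ∨
      G.dist v (f v) = G.dist v c ∧ e (f v) ≤ e c := fun v c hc => by
    simpa [Prod.Lex.toLex_le_toLex] using hf v c hc
  have hnear : ∀ v, ∀ c ∈ X, G.dist v (f v) ≤ G.dist v c := fun v c hc => by
    rcases hle v c hc with h | h
    exacts [h.le, h.1.le]
  have hself : ∀ c ∈ X, f c = c := fun c hc => by
    have := hnear c c hc
    rw [dist_self, Nat.le_zero, hG.dist_eq_zero_iff] at this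
    exact this.symm
  have hreach : ∀ v, G.ReachableIn (f ⁻¹' {f v}) v (f v) := by
    intro v
    obtain ⟨γ, h0, hn, hadj, hdist⟩ := hG.exists_geodesic v (f v)
    have := ReachableIn.of_sequence (A := f ⁻¹' {f v}) (Nat.zero_le _) (fun i _ hi => hadj i hi)
      (fun i _ hi => by
        -- an element of `X` preferred by `γ i` to `f v` would also be preferred by `v`
        have h1 := hG.dist_le_of_sequence hi fun j _ hj => hadj j hj
        rw [hn] at h1
        have h2 := hG.dist_triangle (u := v) (v := γ i) (w := f (γ i))
        have h3 := hdist i hi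
        have h4 := hle (γ i) (f v) (hfX v)
        have h5 := hle v (f (γ i)) (hfX _)
        refine e.injective (le_antisymm ?_ ?_)
        · rcases h4 with h4 | h4
          · omega
          · exact h4.2
        · rcases h5 with h5 | h5
          · omega
          · exact h5.2)
    rwa [h0, hn] at this
  refine ⟨f, hfX, hnear, fun c hc => ⟨⟨c, hself c hc⟩, fun u hu v hv => ?_⟩⟩
  have h1 := hreach u
  have h2 := hreach v
  rw [show f u = c from hu] at h1
  rw [show f v = c from hv] at h2
  exact h1.trans h2.symm

/-- A maximal `n`-separated subset of `O`. -/
theorem exists_maximal_separated [Finite V] (G : SimpleGraph V) {O : Set V} (hO : O.Nonempty)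
    (n : ℕ) :
    ∃ X : Finset V, X.Nonempty ∧ (X : Set V) ⊆ O ∧
      (∀ x ∈ X, ∀ y ∈ X, G.dist x y ≤ n → x = y) ∧ ∀ y ∈ O, ∃ x ∈ X, G.dist y x ≤ n := by
  classical
  have := Fintype.ofFinite V
  let P : Finset V → Prop := fun X =>
    (X : Set V) ⊆ O ∧ ∀ x ∈ X, ∀ y ∈ X, G.dist x y ≤ n → x = y
  obtain ⟨X, hX, hmax⟩ := Finset.exists_max_image (Finset.univ.filter P) Finset.card
    ⟨∅, by simp [P]⟩
  obtain ⟨hXO, hXs⟩ := (Finset.mem_filter.1 hX).2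
  have hcov : ∀ y ∈ O, ∃ x ∈ X, G.dist y x ≤ n := by
    intro y hy
    by_contra! hcon
    have hyX : y ∉ X := fun h => by simpa using hcon y h
    have := hmax (insert y X) (Finset.mem_filter.2 ⟨Finset.mem_univ _, ?_, ?_⟩)
    · rw [Finset.card_insert_of_notMem hyX] at this
      omega
    · rw [Finset.coe_insert]
      exact Set.insert_subset hy hXO
    · intro a ha b hb hab
      rcases Finset.mem_insert.1 ha with rfl | ha <;> rcases Finset.mem_insert.1 hb with rfl | hb
      · rfl
      · exact absurd hab (not_le.2 (hcon b hb))
      · rw [dist_comm] at hab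
        exact absurd hab (not_le.2 (hcon _ ‹_›))
      · exact hXs a ‹_› b ‹_› hab
  obtain ⟨y, hy⟩ := hO
  obtain ⟨x, hx, -⟩ := hcov y hy
  exact ⟨X, ⟨x, hx⟩, hXO, hXs, hcov⟩

open scoped Classical in
/-- If the vertices of a set `O` that comes within distance `1` of every vertex have many branches
around balls of radius `k`, then contracting the Voronoi cells of a maximal `2 * k`-separated subset
of `O` yields a graph of large minimum degree: each branch at a centre `c` is entered by a cell
adjacent to that of `c`, and a cell that avoids the ball around `c` cannot enter two branches. The
cells have radius at most `2 * k + 1`, so a cell adjacent to that of `c` lies within distance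
`(2 * k + 2) + 2 * (2 * k + 1) = 6 * k + 4` of `c`. -/
theorem HasBranches.hasCliqueModel [Finite V] (hG : G.Connected) {O : Set V} (hne : O.Nonempty)
    (hO : ∀ v, ∃ y ∈ O, G.dist v y ≤ 1) {h k : ℕ}
    (hbr : ∀ x ∈ O, G.HasBranches x (2 * 2 ^ h) k (6 * k + 4)) :
    G.HasCliqueModel Set.univ h := by
  obtain ⟨X, hXne, hXO, hXs, hXc⟩ := exists_maximal_separated G hne (2 * k)
  obtain ⟨f, hfX, hnear, hcell⟩ := hG.exists_voronoi hXne
  have hrad : ∀ v, G.dist v (f v) ≤ 2 * k + 1 := by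
    intro v
    obtain ⟨y, hy, hvy⟩ := hO v
    obtain ⟨c, hc, hyc⟩ := hXc y hy
    have h1 := hnear v c hc
    have h2 := hG.dist_triangle (u := v) (v := y) (w := c)
    omega
  have hball : ∀ c ∈ X, ∀ v, G.dist c v ≤ k → f v = c := by
    intro c hc v hv
    have h1 := hnear v c hc
    have h2 := hG.dist_triangle (u := f v) (v := v) (w := c)
    rw [dist_comm (u := f v) (v := v)] at h2
    rw [dist_comm] at hv
    exact hXs _ (hfX v) c hc (by omega)
  obtain ⟨Q, hQ⟩ : ∃ Q : SimpleGraph V, ∀ a b, Q.Adj a b ↔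
      a ≠ b ∧ ∃ u v, f u = a ∧ f v = b ∧ G.Adj u v :=
    ⟨{ Adj := fun a b => a ≠ b ∧ ∃ u v, f u = a ∧ f v = b ∧ G.Adj u v
       symm := ⟨fun a b ⟨hab, u, v, hu, hv, huv⟩ => ⟨hab.symm, v, u, hv, hu, huv.symm⟩⟩
       loopless := ⟨fun a h => h.1 rfl⟩ }, fun _ _ => Iff.rfl⟩
  refine HasCliqueModel.of_fibers (Q := Q) (f := f) (U := X) hcell
    (fun c c' hcc => ((hQ c c').1 hcc).2) ?_
  refine hasCliqueModel_of_le_degreeSumIn h X hXne ?_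
  refine le_degreeSumIn fun c hc => ?_
  obtain ⟨s, hm, hsR, hs⟩ := hbr c (hXO hc)
  refine hm.trans ?_
  have hcc : f c = c := hball c hc c (by simp)
  have hexit : ∀ v ∈ s, ∃ u, f u ≠ c ∧ Q.Adj c (f u) ∧ G.dist c u ≤ 2 * k + 2 ∧
      G.ReachableIn (G.shell c k (6 * k + 4)) u v := by
    intro v hv
    obtain ⟨γ, h0, hn, hadj, hdist⟩ := hG.exists_geodesic c v
    rw [hsR v hv] at hn hadj hdist
    have hvc : f v ≠ c := fun hvc => by
      have := hrad v
      rw [hvc, dist_comm, hsR v hv] at this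
      omega
    -- the first edge of the geodesic from `c` to `v` that leaves the cell of `c`
    have hex : ∃ i, f (γ i) ≠ c := ⟨_, hn.symm ▸ hvc⟩
    have hspec := Nat.find_spec hex
    have hmin := fun i => Nat.find_min hex (m := i)
    have hle : Nat.find hex ≤ 6 * k + 4 := Nat.find_min' hex (hn.symm ▸ hvc)
    generalize Nat.find hex = i at hspec hmin hle
    have hi : i ≠ 0 := by
      rintro rfl
      exact hspec (h0 ▸ hcc)
    obtain ⟨i, rfl⟩ := Nat.exists_eq_succ_of_ne_zero hi
    rw [Nat.succ_eq_add_one] at *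
    have hfi : f (γ i) = c := not_not.1 (hmin i (Nat.lt_succ_self i))
    have h1 := hrad (γ i)
    rw [hfi, dist_comm, hdist i (by omega)] at h1
    have h2 : k < i + 1 := by
      by_contra hlt
      exact hspec (hball c hc _ (by rw [hdist _ hle]; omega))
    refine ⟨γ (i + 1), hspec, 
      (hQ _ _).2 ⟨hspec.symm, γ i, γ (i + 1), hfi, rfl, hadj i hle⟩, ?_, ?_⟩
    · rw [hdist _ hle]
      omega
    · have := ReachableIn.of_sequence (A := G.shell c k (6 * k + 4)) hle (fun j _ hj => hadj j hj)
        (fun j hj hj' => by constructor <;> rw [hdist j hj'] <;> omega)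
      rwa [hn] at this
  choose! g hgc hgQ hgd hgr using hexit
  refine Finset.card_le_card_of_injOn (fun v => f (g v))
    (fun v hv => Finset.mem_filter.2 ⟨hfX _, hgQ v hv⟩) fun v hv w hw hvw => ?_
  -- a common cell would join the two branches outside the ball of radius `k` around `c`
  by_contra hne
  refine hs hv hw hne ((hgr v hv).symm.trans (ReachableIn.trans ?_ (hgr w hw)))
  refine ((hcell (f (g v)) (hfX _)).2 (g v) rfl (g w) hvw.symm).mono fun z hz => ⟨?_, ?_⟩
  · by_contra hlt
    exact hgc v hv ((show f z = f (g v) from hz) ▸ hball c hc z (by omega))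
  · have h1 := hG.dist_triangle (u := c) (v := g v) (w := z)
    have h2 := hG.dist_triangle (u := g v) (v := f (g v)) (w := z)
    have h3 := hrad (g v)
    have h4 := hrad z
    rw [show f z = f (g v) from hz, dist_comm] at h4
    have h5 := hgd v hv
    omega

/-- Local branching into three at one vertex, up to a large enough distance, forces a clique minor
in a finite edge-transitive graph. -/
theorem exists_forall_le_hadwigerNumber (h r : ℕ) : ∃ N : ℕ, ∀ (V : Type*) [Finite V]
    (G : SimpleGraph V) (o : V), G.Connected → G.IsEdgeTransitive →
    (∀ R, r < R → R ≤ N → G.HasBranches o 3 r R) → h ≤ G.hadwigerNumber := by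
  obtain ⟨k, c, hrk, hk⟩ := exists_hasBranches_add r (2 * 2 ^ h)
  refine ⟨6 * k + 4 + c, fun V _ G o hG het hbr => ?_⟩
  let O : Set V := {x | ∃ σ : G ≃g G, σ o = x}
  have hnt : Nontrivial V := by
    obtain ⟨s, hs, -⟩ := hbr (6 * k + 4) (by omega) (by omega)
    obtain ⟨a, -, b, -, hab⟩ := Finset.one_lt_card.1 (show 1 < s.card by omega)
    exact ⟨a, b, hab⟩
  have hnb : ∀ v, ∃ w, G.Adj v w := fun v => hG.preconnected.exists_adj_of_nontrivial v
  have hO : ∀ u v, G.Adj u v → u ∈ O ∨ v ∈ O := by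
    intro u v huv
    obtain ⟨p, hop⟩ := hnb o
    obtain ⟨σ, hσ⟩ := het s(o, p) hop s(u, v) huv
    have : σ o ∈ s(u, v) := hσ ▸ by simp
    rcases Sym2.mem_iff.1 this with h | h
    exacts [Or.inl ⟨σ, h⟩, Or.inr ⟨σ, h⟩]
  have hbrO : ∀ x ∈ O, ∀ R, r < R → R ≤ 6 * k + 4 + c → G.HasBranches x 3 r R := by
    rintro _ ⟨σ, rfl⟩ R h1 h2
    exact (hbr R h1 h2).map_iso hG σ
  have hoO : O.Nonempty := ⟨o, RelIso.refl _, rfl⟩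
  have hO1 : ∀ v, ∃ y ∈ O, G.dist v y ≤ 1 := by
    intro v
    obtain ⟨w, hw⟩ := hnb v
    rcases hO v w hw with h | h
    · exact ⟨v, h, by simp⟩
    · exact ⟨w, h, (dist_eq_one_iff_adj.2 hw).le⟩
  have hbig : ∀ x ∈ O, G.HasBranches x (2 * 2 ^ h) k (6 * k + 4) := by
    intro x hx
    obtain ⟨s, hs, hs'⟩ := hk V G O hG hO (6 * k + 4) (by omega) hbrO x hx
    exact ⟨s, by omega, hs'⟩
  exact (HasBranches.hasCliqueModel hG hoO hO1 hbig).le_hadwigerNumber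

end SimpleGraph

/-! ### Distances and labels -/

namespace NatGraph

open SimpleGraph

variable {G : NatGraph} {o : G.verts}

theorem IsBFSLabeled.lt_of_dist_lt (hG : G.IsBFSLabeled) (ho : o.1 = 1) {u v : G.verts}
    (h : G.coe.dist o u < G.coe.dist o v) : u.1 < v.1 := by
  by_contra hle
  rcases (not_lt.1 hle).lt_or_eq with hlt | heq
  · have := hG.dist_le o v u ho hlt
    omega
  · rw [Subtype.ext heq] at h
    exact lt_irrefl _ h

/-- Labels increase along a geodesic from the root, so a label exceeds the distance from the
root. -/
theorem IsBFSLabeled.dist_lt (hG : G.IsBFSLabeled) (hc : G.coe.Connected) (ho : o.1 = 1)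
    (v : G.verts) : G.coe.dist o v < v.1 := by
  obtain ⟨γ, h0, hn, -, hdist⟩ := hc.exists_geodesic o v
  have : ∀ i ≤ G.coe.dist o v, i < (γ i).1 := by
    intro i
    induction i with
    | zero => intro _; rw [h0, ho]; exact Nat.zero_lt_one
    | succ i ih =>
      intro hi
      have h1 := ih (by omega)
      have h2 := hG.lt_of_dist_lt ho (u := γ i) (v := γ (i + 1))
        (by rw [hdist i (by omega), hdist _ hi]; omega)
      omega
  simpa [hn] using this _ le_rfl

end NatGraph

/-- A ball of radius `R` in a graph of maximum degree `d` has at most `(d + 1) ^ R` vertices. -/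
theorem SimpleGraph.Connected.encard_setOf_dist_le {V : Type*} {G : SimpleGraph V}
    (hG : G.Connected) {d : ℕ} (hd : ∀ v, (G.neighborSet v).encard ≤ d) (o : V) (R : ℕ) :
    {v | G.dist o v ≤ R}.encard ≤ (d + 1) ^ R := by
  induction R with
  | zero =>
    have : {v | G.dist o v ≤ 0} = {o} := by
      ext v
      simp [hG.dist_eq_zero_iff, eq_comm]
    rw [this]; simp
  | succ R ih =>
    have hfin : {v | G.dist o v ≤ R}.Finite :=
      Set.finite_of_encard_le_coe (k := (d + 1) ^ R) (by exact_mod_cast ih)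
    have hsub : {v | G.dist o v ≤ R + 1} ⊆
        ⋃ u ∈ hfin.toFinset, insert u (G.neighborSet u) := by
      intro v hv
      rcases Nat.le_or_eq_of_le_succ hv with h | h
      · exact Set.mem_biUnion (x := v) (by simpa using h) (by simp)
      · obtain ⟨γ, -, hn, hadj, hdist⟩ := hG.exists_geodesic o v
        rw [h] at hn hadj hdist
        refine Set.mem_biUnion (x := γ R) (by simp [hdist R (by omega)]) ?_
        right
        have := hadj R (by omega)
        rwa [← Nat.succ_eq_add_one, hn] at this
    calc _ ≤ _ := Set.encard_le_encard hsub
      _ ≤ ∑ u ∈ hfin.toFinset, (insert u (G.neighborSet u)).encard :=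
        Finset.set_encard_biUnion_le _ _
      _ ≤ ∑ u ∈ hfin.toFinset, ((d : ℕ∞) + 1) := by
        refine Finset.sum_le_sum fun u _ => (Set.encard_insert_le _ _).trans ?_
        gcongr
        exact hd u
      _ = {v | G.dist o v ≤ R}.encard * (d + 1) := by
        rw [Finset.sum_const, hfin.encard_eq_coe_toFinset_card, nsmul_eq_mul]
      _ ≤ _ := by rw [pow_succ]; gcongr

namespace NatGraph

open SimpleGraph

variable {G : NatGraph} {o : G.verts}

/-- A ball around the root is an initial segment of the labels, so the bound on its size bounds its
labels. -/
theorem IsBFSLabeled.le_pow_of_dist_le (hG : G.IsBFSLabeled) (hc : G.coe.Connected) {d : ℕ}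
    (hd : ∀ v, (G.coe.neighborSet v).encard ≤ d) (ho : o.1 = 1) {R : ℕ} {v : G.verts}
    (h : G.coe.dist o v ≤ R) : v.1 ≤ (d + 1) ^ R := by
  obtain ⟨n, -, hn⟩ := hG.verts_eq
  have hsub : Set.Icc 1 v.1 ⊆ Subtype.val '' {w | G.coe.dist o w ≤ R} := by
    intro i hi
    have hv : v.1 ∈ Set.Icc 1 n := hn ▸ v.2
    have hiG : i ∈ G.verts := hn ▸ ⟨hi.1, hi.2.trans hv.2⟩
    refine ⟨⟨i, hiG⟩, ?_, rfl⟩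
    rcases hi.2.lt_or_eq with hlt | heq
    · exact (hG.dist_le o ⟨i, hiG⟩ v ho hlt).trans h
    · rwa [Set.mem_ofPred_eq, show (⟨i, hiG⟩ : G.verts) = v from Subtype.ext heq]
  have h1 := (Set.encard_le_encard hsub).trans
    ((Set.encard_image_le _ _).trans (hc.encard_setOf_dist_le hd o R))
  rw [Set.encard_eq_coe_toFinset_card, Set.toFinset_Icc, Nat.card_Icc, Nat.add_sub_cancel] at h1
  exact_mod_cast h1

/-! ### Branches in the graphs of a convergent sequence -/

/-- Up to any given label, the edges of a convergent sequence eventually are edges of the limit. -/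
theorem Converges.eventually_adj_limit {G : ℕ → NatGraph} (h : Converges G) (T : ℕ) :
    ∀ᶠ j in atTop, ∀ u ≤ T, ∀ v ≤ T, (G j).Adj u v → (limit G).Adj u v := by
  refine (Set.finite_Iic T).eventually_all.2 fun u _ => (Set.finite_Iic T).eventually_all.2
    fun v _ => ?_
  obtain ⟨n₀, hn⟩ := h.2 s(u, v)
  filter_upwards [eventually_ge_atTop n₀] with j hj hadj
  exact eventually_atTop.2 ⟨n₀, fun m hm => (hn m hm).2 ((hn j hj).1 hadj)⟩

/-- A walk of `H` with labels at most `T` avoiding the labels in `S` is also a walk of `L - S`, if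
all edges of `H` up to the label `T` are edges of `L`. -/
theorem componentComplMk_eq_of_walk {H L : NatGraph} {T : ℕ}
    (hHL : ∀ u ≤ T, ∀ v ≤ T, H.Adj u v → L.Adj u v) {S : Set L.verts} {u v : H.verts}
    (p : H.coe.Walk u v) (hp : ∀ w ∈ p.support, w.1 ≤ T ∧ ∀ s ∈ S, s.1 ≠ w.1)
    {u' v' : L.verts} (hu' : u'.1 = u.1) (hv' : v'.1 = v.1) (hu : u' ∉ S) (hv : v' ∉ S) :
    L.coe.componentComplMk hu = L.coe.componentComplMk hv := by
  induction p generalizing u' with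
  | nil =>
    obtain rfl : u' = v' := Subtype.ext (hu'.trans hv'.symm)
    rfl
  | @cons a b c hadj p ih =>
    have hab : L.Adj a.1 b.1 := hHL _ (hp a (by simp)).1 _ (hp b (by simp)).1 hadj
    have hbS : (⟨b.1, L.edge_vert hab.symm⟩ : L.verts) ∉ S := fun h => (hp b (by simp)).2 _ h rfl
    refine Eq.trans ?_ (ih (fun w hw => hp w (by simp [hw])) (u' := ⟨b.1, L.edge_vert hab.symm⟩)
      rfl hv' hbS)
    refine L.coe.componentComplMk_eq_of_adj hu hbS ?_
    rw [Subgraph.coe_adj, hu']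
    exact hab

/-- More than two ends give three pairwise inequivalent rays. -/
theorem _root_.SimpleGraph.exists_rays_of_two_lt_card {V : Type*} {G : SimpleGraph V}
    (h : 2 < ENat.card G.RayEnds) :
    ∃ ρ : Fin 3 → G.Ray, ∀ a b, a ≠ b → ¬ (ρ a).Equivalent (ρ b) := by
  obtain ⟨f⟩ : Nonempty (Fin 3 ↪ G.RayEnds) := by
    cases finite_or_infinite G.RayEnds
    · have := Fintype.ofFinite G.RayEnds
      rw [ENat.card_eq_coe_fintype_card] at h
      refine Function.Embedding.nonempty_of_card_le ?_
      rw [Fintype.card_fin]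
      exact_mod_cast h
    · exact ⟨Fin.valEmbedding.trans (Infinite.natEmbedding _)⟩
  choose ρ hρ using fun a => Quotient.exists_rep (f a)
  refine ⟨ρ, fun a b hab he => hab (f.injective ?_)⟩
  rw [← hρ a, ← hρ b]
  exact Quotient.sound he

/-- If the limit has more than two ends, then every graph far enough in the sequence has at least
three branches at the root up to any given distance `R`. -/
theorem Converges.eventually_hasBranches {G : ℕ → NatGraph} {d : ℕ}
    (hbfs : ∀ j, (G j).IsBFSLabeled) (hconn : ∀ j, (G j).coe.Connected)
    (hdeg : ∀ j, ∀ v : (G j).verts, ((G j).coe.neighborSet v).encard ≤ d) (hconv : Converges G)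
    (hends : 2 < ENat.card (limit G).coe.RayEnds) (o : ∀ j, (G j).verts) (ho : ∀ j, (o j).1 = 1) :
    ∃ r, ∀ R, r < R → ∀ᶠ j in atTop, (G j).coe.HasBranches (o j) 3 r R := by
  classical
  obtain ⟨ρ, hρ⟩ := exists_rays_of_two_lt_card hends
  have hS : ∀ a b, ∃ S : Set (limit G).verts, S.Finite ∧
      (a ≠ b → ∀ C : (limit G).coe.ComponentCompl S,
        ¬ ((∀ᶠ n in atTop, (ρ a).vert n ∈ C) ∧ ∀ᶠ n in atTop, (ρ b).vert n ∈ C)) := by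
    intro a b
    by_cases hab : a = b
    · exact ⟨∅, Set.finite_empty, fun h => absurd hab h⟩
    · have := hρ a b hab
      simp only [Ray.Equivalent, not_forall, not_exists] at this
      obtain ⟨S, hS, hC⟩ := this
      exact ⟨S, hS, fun _ => hC⟩
  choose S hSfin hS using hS
  -- a bound for the labels, and hence for the distances from the root, of the separating sets
  obtain ⟨r, hr⟩ : ∃ r, ∀ a b, ∀ s ∈ S a b, s.1 ≤ r := by
    obtain ⟨r, hr⟩ := (((Set.finite_iUnion fun a => Set.finite_iUnion (hSfin a)).image
      Subtype.val).bddAbove : BddAbove (Subtype.val '' ⋃ a, ⋃ b, S a b))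
    exact ⟨r, fun a b s hs => hr ⟨s, Set.mem_iUnion₂.2 ⟨a, b, hs⟩, rfl⟩⟩
  refine ⟨r, fun R hR => ?_⟩
  set M := max r ((d + 1) ^ R) with hM
  have htail : ∀ a, ∃ n₀, ∀ n ≥ n₀, M < ((ρ a).vert n).1 := fun a => by
    have hinj : Function.Injective fun n => ((ρ a).vert n).1 :=
      Subtype.val_injective.comp (ρ a).injective
    exact eventually_atTop.1 ((hinj.nat_tendsto_atTop).eventually_gt_atTop M)
  choose n₀ hn₀ using htail
  set P : Fin 3 → (limit G).verts := fun a => (ρ a).vert (n₀ a) with hP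
  obtain ⟨T, hT⟩ : ∃ T, M ≤ T ∧ ∀ a, (P a).1 ≤ T :=
    ⟨max M (Finset.univ.sup fun a => (P a).1), le_max_left _ _, fun a =>
      (Finset.le_sup (f := fun a => (P a).1) (Finset.mem_univ a)).trans (le_max_right _ _)⟩
  have hPmem : ∀ᶠ j in atTop, ∀ a, (P a).1 ∈ (G j).verts := eventually_all.2 fun a => (P a).2
  filter_upwards [hconv.eventually_adj_limit T, hPmem] with j hadjT hPj
  have hlt : ∀ a b, ∀ s ∈ S a b, ∀ w : (G j).verts, r < (G j).coe.dist (o j) w → s.1 ≠ w.1 := by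
    intro a b s hs w hw hsw
    have h1 := (hbfs j).dist_lt (hconn j) (ho j) w
    have h2 := hr a b s hs
    omega
  -- descend from the ray to the sphere of radius `R`
  have hdesc : ∀ a, ∃ u : (G j).verts, (G j).coe.dist (o j) u = R ∧
      ∃ p : (G j).coe.Walk ⟨(P a).1, hPj a⟩ u, ∀ w ∈ p.support, w.1 ≤ T ∧
        R ≤ (G j).coe.dist (o j) w := by
    intro a
    set v : (G j).verts := ⟨(P a).1, hPj a⟩
    have hv : R < (G j).coe.dist (o j) v := by
      by_contra hle
      have h1 := (hbfs j).le_pow_of_dist_le (hconn j) (hdeg j) (ho j) (not_lt.1 hle)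
      have h2 : M < v.1 := hn₀ a _ le_rfl
      omega
    obtain ⟨γ, h0, hn, hadj, hdist⟩ := (hconn j).exists_geodesic (o j) v
    have h1 := ReachableIn.of_sequence
      (A := {w : (G j).verts | w.1 ≤ T ∧ R ≤ (G j).coe.dist (o j) w}) hv.le
      (fun i _ hi => hadj i hi) (fun i hi hi' => ⟨?_, (hdist i hi').symm ▸ hi⟩)
    · rw [hn] at h1
      obtain ⟨p, hp⟩ := h1.symm
      exact ⟨γ R, hdist R hv.le, p, hp⟩
    · refine le_trans ?_ (hT.2 a)
      rcases hi'.lt_or_eq with h | h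
      · exact ((hbfs j).lt_of_dist_lt (ho j) (u := γ i) (v := v) (by rwa [hdist i hi'])).le
      · rw [h, hn]
  choose u huR p hp using hdesc
  have hsep : ∀ a b, a ≠ b → ¬ (G j).coe.ReachableIn ((G j).coe.shell (o j) r R) (u a) (u b) := by
    rintro a b hab ⟨q, hq⟩
    have htailS : ∀ c, ∀ n ≥ n₀ c, (ρ c).vert n ∉ S a b := fun c n hn h => by
      have h1 := hn₀ c n hn
      have h2 := hr a b _ h
      omega
    have hray : ∀ c, ∀ n (hn : n ≥ n₀ c),
        (ρ c).vert n ∈ (limit G).coe.componentComplMk (htailS c (n₀ c) le_rfl) := by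
      intro c n hn
      induction n, hn using Nat.le_induction with
      | base => exact ⟨_, rfl⟩
      | succ n hn ih =>
        exact ComponentCompl.mem_of_adj _ _ ih (htailS c _ (by omega)) ((ρ c).adj n)
    have hPP := componentComplMk_eq_of_walk hadjT (S := S a b)
      ((p a).append (q.append (p b).reverse)) (fun w hw => ?_) (u' := P a) (v' := P b)
      rfl rfl (htailS a _ le_rfl) (htailS b _ le_rfl)
    · refine hS a b hab _ ⟨eventually_atTop.2 ⟨n₀ a, hray a⟩, eventually_atTop.2 ⟨n₀ b, ?_⟩⟩
      rw [hPP]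
      exact hray b
    · simp only [Walk.mem_support_append_iff, Walk.support_reverse, List.mem_reverse] at hw
      rcases hw with hw | hw | hw
      · exact ⟨(hp a w hw).1, fun s hs => hlt a b s hs w (hR.trans_le (hp a w hw).2)⟩
      · refine ⟨?_, fun s hs => hlt a b s hs w (hq w hw).1⟩
        have := (hbfs j).le_pow_of_dist_le (hconn j) (hdeg j) (ho j) (hq w hw).2
        omega
      · exact ⟨(hp b w hw).1, fun s hs => hlt a b s hs w (hR.trans_le (hp b w hw).2)⟩
  have hinj : Function.Injective u := fun a b hab => by
    by_contra hne
    exact hsep a b hne (hab ▸ .refl ⟨(huR a).symm ▸ hR, (huR a).le⟩)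
  refine ⟨Finset.univ.image u, ?_, ?_, ?_⟩
  · rw [Finset.card_image_of_injective _ hinj]; simp
  · intro v hv
    obtain ⟨a, -, rfl⟩ := Finset.mem_image.1 hv
    exact huR a
  · intro v hv w hw hvw
    obtain ⟨a, -, rfl⟩ := Finset.mem_image.1 hv
    obtain ⟨b, -, rfl⟩ := Finset.mem_image.1 hw
    exact hsep a b fun e => hvw (e ▸ rfl)

end NatGraph

theorem mainTheorem6 (G : ℕ → NatGraph) (d : ℕ)
    (hbfs : ∀ j, (G j).IsBFSLabeled)
    (hconn : ∀ j, (G j).coe.Connected)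
    (hedge : ∀ j, (G j).coe.IsEdgeTransitive)
    (hdeg : ∀ j, ∀ v : (G j).verts, ((G j).coe.neighborSet v).encard ≤ d)
    (hconv : NatGraph.Converges G)
    (hends : 2 < ENat.card (NatGraph.limit G).coe.RayEnds) :
    Filter.Tendsto (fun j => (G j).coe.hadwigerNumber) Filter.atTop Filter.atTop := by
  have hone : ∀ j, 1 ∈ (G j).verts := fun j => by
    obtain ⟨n, hn, h⟩ := (hbfs j).verts_eq
    rw [h]
    exact ⟨le_rfl, hn⟩
  have hfin : ∀ j, Finite (G j).verts := fun j => by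
    obtain ⟨n, -, h⟩ := (hbfs j).verts_eq
    rw [h]
    exact (Set.finite_Icc 1 n).to_subtype
  obtain ⟨r, hr⟩ := hconv.eventually_hasBranches hbfs hconn hdeg hends (fun j => ⟨1, hone j⟩)
    fun _ => rfl
  refine tendsto_atTop.2 fun h => ?_
  obtain ⟨N, hN⟩ := SimpleGraph.exists_forall_le_hadwigerNumber h r
  have hall : ∀ᶠ j in atTop, ∀ R ≤ N, r < R → (G j).coe.HasBranches ⟨1, hone j⟩ 3 r R :=
    (Set.finite_Iic N).eventually_all.2 fun R _ => eventually_imp_distrib_left.2 (hr R)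
  filter_upwards [hall] with j hj
  have := hfin j
  exact hN _ (G j).coe _ (hconn j) (hedge j) fun R h1 h2 => hj R h2 h1
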